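/- Let $\mathcal A$ be an abelian category with enough projectives and let $F:\mathcal A\to\mathbf{Ab}$ be an additive covariant functor. Let $L_iF$ ($i\ge 0$) be the left derived functors of $F$, let $\lambda_F:L_0F\to F$ be the canonical natural transformation, and let the quot-stabilization $\underline F$ of $F$ be the cokernel of $\lambda_F$. For every object $B$ choose an epimorphism $P(B)\to B$ with $P(B)$ projective, let $\Omega B$ be its kernel, put $\Omega^0B=B$, $\Omega^{n+1}B=\Omega(\Omega^nB)$ and $P_n=P(\Omega^nB)$, and splice the sequences $0\to\Omega^{n+1}B\to P_n\to\Omega^nB\to0$ to a projective resolution $P_\bullet$ of $B$. Since $\underline F$ is additive and vanishes on projectives, $\underline F\circ\Omega^n$ is a functor. The left satellites of $F$ are $S_0F=F$, $(S_1F)(B)=\operatorname{Ker}\big(F(\Omega B)\to F(P_0)\big)$ and $S_{n+1}F=S_1F\circ\Omega^n$. The left fundamental sequence of $F$ is the sequence of functors and natural transformations $$\cdots\to \underline F\circ\Omega^3\to L_2F\to S_2F\to\underline F\circ\Omega^2\to L_1F\to S_1F\to\underline F\circ\Omega\xrightarrow{\ \alpha_F\ }L_0F\xrightarrow{\ \lambda_F\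 }F\to\underline F\to0,$$ where $F\to\underline F$ is the projection and, for every object $B$ and with $(L_nF)(B)=H_n(F(P_\bullet))$, the map $\underline F(\Omega^{n+1}B)\to (L_nF)(B)$ is induced by $F(\Omega^{n+1}B)\to F(P_n)$ (for $n=0$ it is $\alpha_F(B)$), the map $(L_{n}F)(B)\to (S_{n}F)(B)\subseteq F(\Omega^{n}B)$, $n\ge1$, is induced by $F(P_{n})\to F(\Omega^{n}B)$, and $(S_{n}F)(B)\to\underline F(\Omega^{n}B)$, $n\ge1$, is the composite $(S_{n}F)(B)\hookrightarrow F(\Omega^{n}B)\to\underline F(\Omega^{n}B)$. Then: 1. The left fundamental sequence is a complex, whose homology is zero except, possibly, at the terms $L_iF$. 2. If $F$ is half-exact (i.e. for every short exact sequence $0\to X_1\to X_2\to X_3\to0$ the sequence $F(X_1)\to F(X_2)\to F(X_3)$ is exact at $F(X_2)$), then the left fundamental sequence is exact. 3. If $F$ preserves monomorphisms, then $\alpha_F$ is a monomorphism. 4. If $F$ preserves epimorphisms, then $\underline F=0$ and $\lambda_F$ is an epimorphism. 5. $\lambda_F$ is an isomorphism if and only if $F$ is right exact. -/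

import Mathlib

open CategoryTheory CategoryTheory.Limits

universe u v w u' v'

noncomputable section

namespace LeftFundamental

variable {C : Type u} [Category.{v} C] [Abelian C]
variable {D : Type u'} [Category.{v'} D] [Abelian D]

/-- An additive functor is half-exact if it sends every short exact sequence
`0 ⟶ X₁ ⟶ X₂ ⟶ X₃ ⟶ 0` to a sequence exact at `F X₂`. -/
def IsHalfExact (F : C ⥤ D) [F.Additive] : Prop :=
  ∀ S : ShortComplex C, S.ShortExact → (S.map F).Exact

/-! ## Morphisms factoring through projectives -/

/-- Two parallel morphisms are projectively equivalent if their difference factors through a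
projective object. -/
def ProjEq {X Y : C} (f g : X ⟶ Y) : Prop :=
  ∃ (Q : C) (_ : Projective Q) (a : X ⟶ Q) (b : Q ⟶ Y), f - g = a ≫ b

lemma ProjEq.refl {X Y : C} (f : X ⟶ Y) : ProjEq f f := by
  exact ⟨_, (isZero_zero C).projective, 0, 0, by simp⟩

lemma ProjEq.trans {X Y : C} {f g h : X ⟶ Y} (h₁ : ProjEq f g) (h₂ : ProjEq g h) :
    ProjEq f h := by
  obtain ⟨Q, hQ, a, b, e⟩ := h₁
  obtain ⟨Q', hQ', a', b', e'⟩ := h₂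
  refine ⟨Q ⊞ Q', inferInstance, biprod.lift a a', biprod.desc b b', ?_⟩
  rw [biprod.lift_desc, ← e, ← e']
  abel

/-- `G` vanishes on projective objects. -/
def VanishesOnProjectives (G : C ⥤ D) : Prop :=
  ∀ Q : C, Projective Q → IsZero (G.obj Q)

lemma VanishesOnProjectives.map_eq {G : C ⥤ D} [G.Additive] (hG : VanishesOnProjectives G)
    {X Y : C} {f g : X ⟶ Y} (h : ProjEq f g) : G.map f = G.map g := by
  obtain ⟨Q, hQ, a, b, e⟩ := h
  rw [← sub_eq_zero, ← G.map_sub, e, G.map_comp, (hG Q hQ).eq_of_tgt (G.map a) 0, zero_comp]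

variable [EnoughProjectives C]

/-! ## Syzygies -/

/-- The syzygy object `Ω B`: the kernel of the chosen epimorphism `Projective.over B ⟶ B` from a
projective object. -/
def syz (B : C) : C := kernel (Projective.π B)

/-- The inclusion of `Ω B` in the chosen projective. -/
def syzι (B : C) : syz B ⟶ Projective.over B := kernel.ι (Projective.π B)

instance (B : C) : Mono (syzι B) := inferInstanceAs (Mono (kernel.ι _))

lemma syzι_π (B : C) : syzι B ≫ Projective.π B = 0 := kernel.condition _

lemma syzι_π_assoc (B : C) {Z : C} (h : B ⟶ Z) : syzι B ≫ Projective.π B ≫ h = 0 := by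
  rw [← Category.assoc, syzι_π, zero_comp]

/-- Morphisms to `Ω B` are morphisms to the chosen projective which are killed by the projection
to `B`. -/
def syzLift {X B : C} (k : X ⟶ Projective.over B) (hk : k ≫ Projective.π B = 0) : X ⟶ syz B :=
  kernel.lift _ k hk

lemma syzLift_ι {X B : C} (k : X ⟶ Projective.over B) (hk : k ≫ Projective.π B = 0) :
    syzLift k hk ≫ syzι B = k := kernel.lift_ι _ _ _

/-- A chosen lift of a morphism to the chosen projectives. -/
def overMap {B B' : C} (f : B ⟶ B') : Projective.over B ⟶ Projective.over B' :=
  Projective.factorThru (Projective.π B ≫ f) (Projective.π B')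

lemma overMap_π {B B' : C} (f : B ⟶ B') :
    overMap f ≫ Projective.π B' = Projective.π B ≫ f := Projective.factorThru_comp _ _

/-- The operation `Ω` on morphisms (functorial only modulo projectives). -/
def syzMap {B B' : C} (f : B ⟶ B') : syz B ⟶ syz B' :=
  syzLift (syzι B ≫ overMap f) (by rw [Category.assoc, overMap_π, syzι_π_assoc])

lemma syzMap_ι {B B' : C} (f : B ⟶ B') : syzMap f ≫ syzι B' = syzι B ≫ overMap f :=
  syzLift_ι _ _

/-- Two morphisms on syzygies induced by projectively equivalent morphisms differ by a morphism
which extends to the ambient projective. -/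
lemma exists_eq_syzι_comp {B B' : C} {f g : B ⟶ B'} (h : ProjEq f g)
    {φ ψ : Projective.over B ⟶ Projective.over B'} {σ τ : syz B ⟶ syz B'}
    (hφ : φ ≫ Projective.π B' = Projective.π B ≫ f)
    (hψ : ψ ≫ Projective.π B' = Projective.π B ≫ g)
    (hσ : σ ≫ syzι B' = syzι B ≫ φ) (hτ : τ ≫ syzι B' = syzι B ≫ ψ) :
    ∃ k : Projective.over B ⟶ syz B', σ - τ = syzι B ≫ k := by
  obtain ⟨Q, hQ, a, b, e⟩ := h
  refine ⟨syzLift (φ - ψ - Projective.π B ≫ a ≫ Projective.factorThru b (Projective.π B')) ?_, ?_⟩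
  · simp only [Preadditive.sub_comp, Category.assoc, Projective.factorThru_comp, hφ, hψ, ← e,
      Preadditive.comp_sub, sub_self]
  · rw [← cancel_mono (syzι B'), Category.assoc, syzLift_ι, Preadditive.sub_comp, hσ, hτ,
      Preadditive.comp_sub, Preadditive.comp_sub, syzι_π_assoc, sub_zero]

lemma exists_syzMap_sub {B B' : C} {f g : B ⟶ B'} (h : ProjEq f g) :
    ∃ k : Projective.over B ⟶ syz B', syzMap f - syzMap g = syzι B ≫ k :=
  exists_eq_syzι_comp h (overMap_π f) (overMap_π g) (syzMap_ι f) (syzMap_ι g)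

lemma exists_syzMap_id (B : C) :
    ∃ k : Projective.over B ⟶ syz B, syzMap (𝟙 B) - 𝟙 (syz B) = syzι B ≫ k :=
  exists_eq_syzι_comp (ProjEq.refl (𝟙 B)) (overMap_π _) (ψ := 𝟙 _) (by simp) (syzMap_ι _)
    (by simp)

lemma exists_syzMap_comp {B B' B'' : C} (f : B ⟶ B') (g : B' ⟶ B'') :
    ∃ k : Projective.over B ⟶ syz B'',
      syzMap (f ≫ g) - syzMap f ≫ syzMap g = syzι B ≫ k :=
  exists_eq_syzι_comp (ProjEq.refl (f ≫ g)) (overMap_π _) (ψ := overMap f ≫ overMap g)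
    (by rw [Category.assoc, overMap_π, ← Category.assoc, overMap_π, Category.assoc])
    (syzMap_ι _)
    (by rw [Category.assoc, syzMap_ι, ← Category.assoc, syzMap_ι, Category.assoc])

lemma exists_syzMap_add {B B' : C} (f g : B ⟶ B') :
    ∃ k : Projective.over B ⟶ syz B', syzMap (f + g) - (syzMap f + syzMap g) = syzι B ≫ k :=
  exists_eq_syzι_comp (ProjEq.refl (f + g)) (overMap_π _) (ψ := overMap f + overMap g)
    (by rw [Preadditive.add_comp, overMap_π, overMap_π, Preadditive.comp_add])
    (syzMap_ι _)
    (by rw [Preadditive.add_comp, syzMap_ι, syzMap_ι, Preadditive.comp_add])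

lemma ProjEq.syzMap {B B' : C} {f g : B ⟶ B'} (h : ProjEq f g) :
    ProjEq (syzMap f) (syzMap g) := by
  obtain ⟨k, hk⟩ := exists_syzMap_sub h
  exact ⟨_, inferInstance, _, k, hk⟩

/-- The iterated syzygy `Ωⁿ B`. -/
def syzPow : ℕ → C → C
  | 0, B => B
  | n + 1, B => syz (syzPow n B)

/-- The operation `Ωⁿ` on morphisms. -/
def syzPowMap : ∀ (n : ℕ) {B B' : C}, (B ⟶ B') → (syzPow n B ⟶ syzPow n B')
  | 0, _, _, f => f
  | n + 1, _, _, f => syzMap (syzPowMap n f)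

lemma syzPowMap_id (n : ℕ) (B : C) : ProjEq (syzPowMap n (𝟙 B)) (𝟙 (syzPow n B)) := by
  induction n with
  | zero => exact ProjEq.refl _
  | succ n ih =>
    obtain ⟨k, hk⟩ := exists_syzMap_id (syzPow n B)
    exact ih.syzMap.trans ⟨_, inferInstance, _, k, hk⟩

lemma syzPowMap_comp (n : ℕ) {B B' B'' : C} (f : B ⟶ B') (g : B' ⟶ B'') :
    ProjEq (syzPowMap n (f ≫ g)) (syzPowMap n f ≫ syzPowMap n g) := by
  induction n with
  | zero => exact ProjEq.refl _
  | succ n ih =>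
    obtain ⟨k, hk⟩ := exists_syzMap_comp (syzPowMap n f) (syzPowMap n g)
    exact ih.syzMap.trans ⟨_, inferInstance, _, k, hk⟩

/-- The functor `G ∘ Ωⁿ`, well defined because `G` is additive and vanishes on projectives. -/
def compSyz (G : C ⥤ D) [G.Additive] (hG : VanishesOnProjectives G) (n : ℕ) : C ⥤ D where
  obj B := G.obj (syzPow n B)
  map f := G.map (syzPowMap n f)
  map_id B := by rw [hG.map_eq (syzPowMap_id n B), G.map_id]
  map_comp f g := by rw [hG.map_eq (syzPowMap_comp n f g), G.map_comp]

/-! ## The first left satellite -/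

lemma kernelι_map_eq (F : C ⥤ D) [F.Additive] {B X : C} {σ τ : syz B ⟶ X}
    (h : ∃ k : Projective.over B ⟶ X, σ - τ = syzι B ≫ k) :
    kernel.ι (F.map (syzι B)) ≫ F.map σ = kernel.ι (F.map (syzι B)) ≫ F.map τ := by
  obtain ⟨k, hk⟩ := h
  rw [← sub_eq_zero, ← Preadditive.comp_sub, ← F.map_sub, hk, F.map_comp,
    kernel.condition_assoc, zero_comp]

/-- The first left satellite `S₁F`, with `(S₁F)(B)` the kernel of `F(Ω B) ⟶ F(P)`, where
`0 ⟶ Ω B ⟶ P ⟶ B ⟶ 0` is the chosen sequence with `P` projective. -/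
def satellite₁ (F : C ⥤ D) [F.Additive] : C ⥤ D where
  obj B := kernel (F.map (syzι B))
  map f := kernel.map _ _ (F.map (syzMap f)) (F.map (overMap f))
    (by rw [← F.map_comp, ← F.map_comp, syzMap_ι])
  map_id B := by
    rw [← cancel_mono (kernel.ι _), kernel.map, kernel.lift_ι,
      kernelι_map_eq F (exists_syzMap_id B), F.map_id, Category.comp_id, Category.id_comp]
  map_comp f g := by
    rw [← cancel_mono (kernel.ι _)]
    simp only [kernel.map, Category.assoc, kernel.lift_ι, kernel.lift_ι_assoc]
    rw [kernelι_map_eq F (exists_syzMap_comp f g), F.map_comp]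

/-- The inclusion `(S₁F)(B) ⟶ F(Ω B)`. -/
def satι (F : C ⥤ D) [F.Additive] (B : C) : (satellite₁ F).obj B ⟶ F.obj (syz B) :=
  kernel.ι (F.map (syzι B))

instance (F : C ⥤ D) [F.Additive] (B : C) : Mono (satι F B) :=
  inferInstanceAs (Mono (kernel.ι (F.map (syzι B))))

lemma satι_condition (F : C ⥤ D) [F.Additive] (B : C) : satι F B ≫ F.map (syzι B) = 0 :=
  kernel.condition _

/-- Morphisms to `(S₁F)(B)`. -/
def satLift (F : C ⥤ D) [F.Additive] {B : C} {X : D} (k : X ⟶ F.obj (syz B))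
    (hk : k ≫ F.map (syzι B) = 0) : X ⟶ (satellite₁ F).obj B :=
  kernel.lift _ k hk

lemma satLift_ι (F : C ⥤ D) [F.Additive] {B : C} {X : D} (k : X ⟶ F.obj (syz B))
    (hk : k ≫ F.map (syzι B) = 0) : satLift F k hk ≫ satι F B = k := kernel.lift_ι _ _ _

lemma satellite₁_map_ι (F : C ⥤ D) [F.Additive] {B B' : C} (f : B ⟶ B') :
    (satellite₁ F).map f ≫ satι F B' = satι F B ≫ F.map (syzMap f) := kernel.lift_ι _ _ _

instance (F : C ⥤ D) [F.Additive] : (satellite₁ F).Additive where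
  map_add {B B' f g} := by
    rw [← cancel_mono (satι F B'), satellite₁_map_ι, Preadditive.add_comp, satellite₁_map_ι,
      satellite₁_map_ι, ← Preadditive.comp_add, ← F.map_add]
    exact kernelι_map_eq F (exists_syzMap_add f g)

lemma satellite₁_vanishes (F : C ⥤ D) [F.Additive] : VanishesOnProjectives (satellite₁ F) := by
  intro Q hQ
  let s := Projective.factorThru (𝟙 Q) (Projective.π Q)
  have hs : s ≫ Projective.π Q = 𝟙 Q := Projective.factorThru_comp _ _
  let r : Projective.over Q ⟶ syz Q := syzLift (𝟙 _ - Projective.π Q ≫ s) (by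
    rw [Preadditive.sub_comp, Category.assoc, hs, Category.id_comp, Category.comp_id, sub_self])
  have hr : syzι Q ≫ r = 𝟙 _ := by
    rw [← cancel_mono (syzι Q), Category.assoc, syzLift_ι, Preadditive.comp_sub, syzι_π_assoc,
      sub_zero, Category.id_comp, Category.comp_id]
  have : IsSplitMono (syzι Q) := ⟨⟨⟨r, hr⟩⟩⟩
  exact isZero_kernel_of_mono (F.map (syzι Q))

/-- The left satellites: `S₀F = F` and `Sₙ₊₁F = S₁F ∘ Ωⁿ`. -/
def satellite (F : C ⥤ D) [F.Additive] : ℕ → (C ⥤ D)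
  | 0 => F
  | n + 1 => compSyz (satellite₁ F) (satellite₁_vanishes F) n

/-! ## The projective resolution spliced from the syzygies -/

/-- The inclusion `Ωⁿ⁺¹ B ⟶ Pₙ`, where `Pₙ` is the chosen projective over `Ωⁿ B`. -/
def syzPowι (n : ℕ) (B : C) : syzPow (n + 1) B ⟶ Projective.over (syzPow n B) :=
  syzι (syzPow n B)

instance (n : ℕ) (B : C) : Mono (syzPowι n B) := inferInstanceAs (Mono (syzι _))

lemma syzPowι_π (n : ℕ) (B : C) : syzPowι n B ≫ Projective.π (syzPow n B) = 0 := syzι_π _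

lemma syzPowι_π_assoc (n : ℕ) (B : C) {Z : C} (h : syzPow n B ⟶ Z) :
    syzPowι n B ≫ Projective.π (syzPow n B) ≫ h = 0 := syzι_π_assoc _ _

lemma syzPowMap_ι (n : ℕ) {B B' : C} (f : B ⟶ B') :
    syzPowMap (n + 1) f ≫ syzPowι n B' = syzPowι n B ≫ overMap (syzPowMap n f) := syzMap_ι _

/-- The complex `⋯ ⟶ P₂ ⟶ P₁ ⟶ P₀` with `Pₙ` the chosen projective over `Ωⁿ B` and
differentials `Pₙ₊₁ ⟶ Ωⁿ⁺¹ B ⟶ Pₙ`. -/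
abbrev syzComplex (B : C) : ChainComplex C ℕ :=
  ChainComplex.of (fun n => Projective.over (syzPow n B))
    (fun n => Projective.π (syzPow (n + 1) B) ≫ syzPowι n B)
    (fun n => by rw [Category.assoc, syzPowι_π_assoc, comp_zero])

lemma syzComplex_d (B : C) (n : ℕ) :
    (syzComplex B).d (n + 1) n = Projective.π (syzPow (n + 1) B) ≫ syzPowι n B :=
  ChainComplex.of_d (fun n => Projective.over (syzPow n B))
    (fun n => Projective.π (syzPow (n + 1) B) ≫ syzPowι n B) n

lemma exact_syz (n : ℕ) (B : C) :
    (ShortComplex.mk (Projective.π (syzPow (n + 1) B) ≫ syzPowι n B) (Projective.π (syzPow n B))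
      (by rw [Category.assoc, syzPowι_π, comp_zero])).Exact := by
  let α : ShortComplex.mk (Projective.π (syzPow (n + 1) B) ≫ syzPowι n B)
      (Projective.π (syzPow n B)) (by rw [Category.assoc, syzPowι_π, comp_zero]) ⟶
      ShortComplex.mk (syzPowι n B) (Projective.π (syzPow n B)) (syzPowι_π n B) :=
    { τ₁ := Projective.π _
      τ₂ := 𝟙 _
      τ₃ := 𝟙 _ }
  have : Epi α.τ₁ := inferInstanceAs (Epi (Projective.π _))
  have : IsIso α.τ₂ := inferInstanceAs (IsIso (𝟙 _))
  have : Mono α.τ₃ := inferInstanceAs (Mono (𝟙 _))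
  rw [ShortComplex.exact_iff_of_epi_of_isIso_of_mono α]
  exact ShortComplex.exact_of_f_is_kernel _ (kernelIsKernel (Projective.π (syzPow n B)))

lemma exact_syz' (n : ℕ) (B : C) :
    (ShortComplex.mk (Projective.π (syzPow (n + 2) B) ≫ syzPowι (n + 1) B)
      (Projective.π (syzPow (n + 1) B) ≫ syzPowι n B)
      (by rw [Category.assoc, syzPowι_π_assoc, comp_zero])).Exact := by
  let α : ShortComplex.mk (Projective.π (syzPow (n + 2) B) ≫ syzPowι (n + 1) B)
      (Projective.π (syzPow (n + 1) B)) (by rw [Category.assoc, syzPowι_π, comp_zero]) ⟶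
      ShortComplex.mk (Projective.π (syzPow (n + 2) B) ≫ syzPowι (n + 1) B)
      (Projective.π (syzPow (n + 1) B) ≫ syzPowι n B)
      (by rw [Category.assoc, syzPowι_π_assoc, comp_zero]) :=
    { τ₁ := 𝟙 _
      τ₂ := 𝟙 _
      τ₃ := syzPowι n B }
  have : Epi α.τ₁ := inferInstanceAs (Epi (𝟙 _))
  have : IsIso α.τ₂ := inferInstanceAs (IsIso (𝟙 _))
  have : Mono α.τ₃ := inferInstanceAs (Mono (syzPowι n B))
  exact (ShortComplex.exact_iff_of_epi_of_isIso_of_mono α).1 (exact_syz (n + 1) B)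

lemma exact_of_eq {X Y Z : C} {f f' : X ⟶ Y} {g g' : Y ⟶ Z} {w : f ≫ g = 0} {w' : f' ≫ g' = 0}
    (hf : f' = f) (hg : g' = g) (h : (ShortComplex.mk f g w).Exact) :
    (ShortComplex.mk f' g' w').Exact := by
  subst hf hg
  exact h

/-- The augmentation `P₀ ⟶ B`. -/
def syzAug (B : C) : syzComplex B ⟶ (ChainComplex.single₀ C).obj B :=
  (ChainComplex.toSingle₀Equiv _ _).symm ⟨Projective.π (syzPow 0 B), by
    refine (congrArg (fun z => z ≫ Projective.π (syzPow 0 B)) (syzComplex_d B 0)).trans ?_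
    exact (Category.assoc _ _ _).trans ((congrArg _ (syzPowι_π 0 B)).trans comp_zero)⟩

lemma syzAug_f (B : C) : (syzAug B).f 0 = Projective.π (syzPow 0 B) :=
  ChainComplex.toSingle₀Equiv_symm_apply_f_zero _ _

lemma syzAug_quasiIso (B : C) : QuasiIso (syzAug B) := ⟨fun n => by
  cases n with
  | zero =>
    rw [ChainComplex.quasiIsoAt₀_iff, ShortComplex.quasiIso_iff_of_zeros']
    · refine (ShortComplex.exact_and_epi_g_iff_of_iso ?_).2
          ⟨exact_syz 0 B, inferInstanceAs (Epi (Projective.π (syzPow 0 B)))⟩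
      refine ShortComplex.isoMk (Iso.refl _) (Iso.refl _) (Iso.refl _) ?_ ?_
      · exact (Category.id_comp _).trans ((syzComplex_d B 0).symm.trans (Category.comp_id _).symm)
      · exact (Category.id_comp _).trans ((syzAug_f B).symm.trans (Category.comp_id _).symm)
    all_goals rfl
  | succ n =>
    rw [quasiIsoAt_iff_exactAt']
    · rw [HomologicalComplex.exactAt_iff' _ (n + 1 + 1) (n + 1) n (by simp) (by simp)]
      exact exact_of_eq (syzComplex_d B (n + 1)) (syzComplex_d B n) (exact_syz' n B)
    · apply ChainComplex.exactAt_succ_single_obj⟩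

/-- The projective resolution of `B` spliced from the sequences
`0 ⟶ Ωⁿ⁺¹ B ⟶ Pₙ ⟶ Ωⁿ B ⟶ 0`. -/
def syzResolution (B : C) : ProjectiveResolution B where
  complex := syzComplex B
  projective n := inferInstanceAs (Projective (Projective.over (syzPow n B)))
  π := syzAug B
  quasiIso := syzAug_quasiIso B

/-- The morphism of spliced resolutions over a morphism `f`, given by the chosen lifts. -/
def syzComplexMap {B B' : C} (f : B ⟶ B') : syzComplex B ⟶ syzComplex B' :=
  ChainComplex.ofHom (fun n => overMap (syzPowMap n f)) (fun n => by
    rw [syzComplex_d, syzComplex_d, Category.assoc]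
    refine Eq.trans ?_ (congrArg _ (syzPowMap_ι n f))
    exact (Category.assoc _ _ _).symm.trans
      ((congrArg (fun z => z ≫ syzPowι n B') (overMap_π (syzPowMap (n + 1) f))).trans
        (Category.assoc _ _ _)))

lemma syzComplexMap_f {B B' : C} (f : B ⟶ B') (n : ℕ) :
    (syzComplexMap f).f n = overMap (syzPowMap n f) := rfl

lemma syzComplexMap_comm {B B' : C} (f : B ⟶ B') :
    (syzComplexMap f).f 0 ≫ (syzResolution B').π.f 0 = (syzResolution B).π.f 0 ≫ f := by
  have h := overMap_π (syzPowMap 0 f)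
  rw [← syzAug_f, ← syzAug_f] at h
  exact h

/-! ## The quot-stabilization -/

/-- The quot-stabilization of `F`: the cokernel of `λ_F : L₀F ⟶ F`. -/
def quotStab (F : C ⥤ D) [F.Additive] : C ⥤ D := cokernel F.fromLeftDerivedZero

/-- The projection of `F` onto its quot-stabilization. -/
def quotProj (F : C ⥤ D) [F.Additive] : F ⟶ quotStab F := cokernel.π F.fromLeftDerivedZero

instance (F : C ⥤ D) [F.Additive] : Epi (quotProj F) :=
  inferInstanceAs (Epi (cokernel.π F.fromLeftDerivedZero))

instance (F : C ⥤ D) [F.Additive] (B : C) : Epi ((quotProj F).app B) := inferInstance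

lemma fromLeftDerivedZero_quotProj (F : C ⥤ D) [F.Additive] (B : C) :
    F.fromLeftDerivedZero.app B ≫ (quotProj F).app B = 0 := by
  rw [← NatTrans.comp_app]
  exact congrArg (fun z : F.leftDerived 0 ⟶ quotStab F => z.app B) (cokernel.condition _)

instance (F : C ⥤ D) [F.Additive] : (quotStab F).Additive where
  map_add {B B' f g} := by
    rw [← cancel_epi ((quotProj F).app B), Preadditive.comp_add, ← NatTrans.naturality,
      ← NatTrans.naturality, ← NatTrans.naturality, F.map_add, Preadditive.add_comp]

lemma quotStab_vanishes (F : C ⥤ D) [F.Additive] : VanishesOnProjectives (quotStab F) := by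
  intro Q hQ
  have h := fromLeftDerivedZero_quotProj F Q
  exact IsZero.of_epi_eq_zero ((quotProj F).app Q)
    ((cancel_epi (F.fromLeftDerivedZero.app Q)).1 (h.trans comp_zero.symm))

lemma fromLeftDerivedZero_comp_eq_zero (F : C ⥤ D) [F.Additive] {B : C} {T : D}
    (g : F.obj B ⟶ T) (hg : F.map (Projective.π B) ≫ g = 0) :
    F.fromLeftDerivedZero.app B ≫ g = 0 := by
  have h : (syzResolution B).fromLeftDerivedZero' F ≫ g = 0 := by
    rw [← cancel_epi (HomologicalComplex.pOpcycles _ _), comp_zero,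
      ProjectiveResolution.pOpcycles_comp_fromLeftDerivedZero'_assoc]
    refine Eq.trans ?_ hg
    exact congrArg (fun z => F.map z ≫ g) (syzAug_f B)
  refine (congrArg (fun z => z ≫ g) ((syzResolution B).fromLeftDerivedZero_eq F)).trans ?_
  refine (Category.assoc _ _ _).trans ?_
  refine (congrArg _ ((Category.assoc _ _ _).trans (congrArg _ h))).trans ?_
  exact (congrArg _ comp_zero).trans comp_zero

/-- Morphisms out of `F B` killed by `F P ⟶ F B` descend to the quot-stabilization. -/
def quotDesc (F : C ⥤ D) [F.Additive] {B : C} {T : D}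
    (g : F.obj B ⟶ T) (hg : F.map (Projective.π B) ≫ g = 0) : (quotStab F).obj B ⟶ T :=
  (PreservesCokernel.iso ((evaluation C D).obj B) F.fromLeftDerivedZero).hom ≫
    cokernel.desc _ g (fromLeftDerivedZero_comp_eq_zero F g hg)

lemma quotProj_desc (F : C ⥤ D) [F.Additive] {B : C} {T : D}
    (g : F.obj B ⟶ T) (hg : F.map (Projective.π B) ≫ g = 0) :
    (quotProj F).app B ≫ quotDesc F g hg = g := by
  have h := PreservesCokernel.π_iso_hom ((evaluation C D).obj B) F.fromLeftDerivedZero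
  refine (Category.assoc _ _ _).symm.trans ?_
  refine (congrArg (fun z => z ≫ cokernel.desc _ g (fromLeftDerivedZero_comp_eq_zero F g hg))
    h).trans ?_
  exact cokernel.π_desc _ _ _

/-- The functors `F̲ ∘ Ωⁿ`, where `F̲` is the quot-stabilization of `F`. -/
def quotStabSyz (F : C ⥤ D) [F.Additive] : ℕ → (C ⥤ D)
  | 0 => quotStab F
  | n + 1 => compSyz (quotStab F) (quotStab_vanishes F) (n + 1)

/-! ## The morphisms of the left fundamental sequence -/

/-- The complex `F(P)`, where `P` is the spliced resolution of `B`. -/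
abbrev mapSyzComplex (F : C ⥤ D) [F.Additive] (B : C) : ChainComplex D ℕ :=
  (F.mapHomologicalComplex (ComplexShape.down ℕ)).obj (syzResolution B).complex

/-- The isomorphism of `(LₙF)(B)` with the homology of `F(P)`. -/
def derivedIso (F : C ⥤ D) [F.Additive] (n : ℕ) (B : C) :
    (F.leftDerived n).obj B ≅ (mapSyzComplex F B).homology n :=
  (syzResolution B).isoLeftDerivedObj F n

/-- The chain map `F(P) ⟶ F(P')` over a morphism `B ⟶ B'`. -/
abbrev mapSyzComplexMap (F : C ⥤ D) [F.Additive] {B B' : C} (f : B ⟶ B') :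
    mapSyzComplex F B ⟶ mapSyzComplex F B' :=
  (F.mapHomologicalComplex (ComplexShape.down ℕ)).map (syzComplexMap f)

lemma derivedIso_hom_naturality (F : C ⥤ D) [F.Additive] (n : ℕ) {B B' : C} (f : B ⟶ B') :
    (F.leftDerived n).map f ≫ (derivedIso F n B').hom =
      (derivedIso F n B).hom ≫ HomologicalComplex.homologyMap (mapSyzComplexMap F f) n :=
  ProjectiveResolution.isoLeftDerivedObj_hom_naturality f (syzResolution B) (syzResolution B')
    (syzComplexMap f) (syzComplexMap_comm f) F n

/-- The inclusion of the syzygy, viewed in `F(P)`. -/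
def mapι (F : C ⥤ D) [F.Additive] (n : ℕ) (B : C) :
    F.obj (syzPow (n + 1) B) ⟶ (mapSyzComplex F B).X n := F.map (syzPowι n B)

/-- The projection onto the syzygy, viewed in `F(P)`. -/
def mapπ (F : C ⥤ D) [F.Additive] (n : ℕ) (B : C) :
    (mapSyzComplex F B).X n ⟶ F.obj (syzPow n B) := F.map (Projective.π (syzPow n B))

lemma mapSyzComplex_d (F : C ⥤ D) [F.Additive] (n : ℕ) (B : C) :
    (mapSyzComplex F B).d (n + 1) n = mapπ F (n + 1) B ≫ mapι F n B :=
  (congrArg F.map (syzComplex_d B n)).trans (F.map_comp _ _)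

lemma mapι_mapπ (F : C ⥤ D) [F.Additive] (n : ℕ) (B : C) : mapι F n B ≫ mapπ F n B = 0 :=
  (F.map_comp _ _).symm.trans ((congrArg F.map (syzPowι_π n B)).trans (F.map_zero _ _))

lemma mapι_d (F : C ⥤ D) [F.Additive] (n : ℕ) (B : C) :
    mapι F n B ≫ (mapSyzComplex F B).d n ((ComplexShape.down ℕ).next n) = 0 := by
  cases n with
  | zero => rw [HomologicalComplex.shape _ _ _ (by simp), comp_zero]
  | succ n =>
    rw [ChainComplex.next_nat_succ, mapSyzComplex_d, ← Category.assoc, mapι_mapπ, zero_comp]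

/-- The morphism `F(Ωⁿ⁺¹ B) ⟶ Hₙ(F(P))` induced by the inclusion `Ωⁿ⁺¹ B ⟶ Pₙ`. -/
def toHomology (F : C ⥤ D) [F.Additive] (n : ℕ) (B : C) :
    F.obj (syzPow (n + 1) B) ⟶ (mapSyzComplex F B).homology n :=
  (mapSyzComplex F B).liftCycles (mapι F n B) _ rfl (mapι_d F n B) ≫
    (mapSyzComplex F B).homologyπ n

lemma mapπ_toHomology (F : C ⥤ D) [F.Additive] (n : ℕ) (B : C) :
    mapπ F (n + 1) B ≫ toHomology F n B = 0 := by
  refine Eq.trans ?_ ((mapSyzComplex F B).toCycles_comp_homologyπ (n + 1) n)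
  refine (Category.assoc _ _ _).symm.trans ?_
  congr 1
  rw [← cancel_mono ((mapSyzComplex F B).iCycles n), Category.assoc,
    HomologicalComplex.liftCycles_i, HomologicalComplex.toCycles_i, mapSyzComplex_d]

lemma toHomology_naturality (F : C ⥤ D) [F.Additive] (n : ℕ) {B B' : C} (f : B ⟶ B') :
    F.map (syzPowMap (n + 1) f) ≫ toHomology F n B' =
      toHomology F n B ≫ HomologicalComplex.homologyMap (mapSyzComplexMap F f) n := by
  rw [toHomology, toHomology, Category.assoc, HomologicalComplex.homologyπ_naturality,
    ← Category.assoc, ← Category.assoc]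
  congr 1
  rw [← cancel_mono ((mapSyzComplex F B').iCycles n), Category.assoc, Category.assoc,
    HomologicalComplex.liftCycles_i, HomologicalComplex.cyclesMap_i,
    HomologicalComplex.liftCycles_i_assoc]
  exact (F.map_comp _ _).symm.trans ((congrArg F.map (syzPowMap_ι n f)).trans (F.map_comp _ _))

/-- The projection `F(Ωⁿ⁺¹ B) ⟶ F̲(Ωⁿ⁺¹ B)`. -/
def quotPowProj (F : C ⥤ D) [F.Additive] (n : ℕ) (B : C) :
    F.obj (syzPow (n + 1) B) ⟶ (quotStabSyz F (n + 1)).obj B :=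
  (quotProj F).app (syzPow (n + 1) B)

instance (F : C ⥤ D) [F.Additive] (n : ℕ) (B : C) : Epi (quotPowProj F n B) :=
  inferInstanceAs (Epi ((quotProj F).app (syzPow (n + 1) B)))

lemma quotPowProj_naturality (F : C ⥤ D) [F.Additive] (n : ℕ) {B B' : C} (f : B ⟶ B') :
    F.map (syzPowMap (n + 1) f) ≫ quotPowProj F n B' =
      quotPowProj F n B ≫ (quotStabSyz F (n + 1)).map f :=
  (quotProj F).naturality (syzPowMap (n + 1) f)

/-- The morphism `F̲(Ωⁿ⁺¹ B) ⟶ Hₙ(F(P))` induced by the inclusion `Ωⁿ⁺¹ B ⟶ Pₙ`. -/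
def quotToHomology (F : C ⥤ D) [F.Additive] (n : ℕ) (B : C) :
    (quotStabSyz F (n + 1)).obj B ⟶ (mapSyzComplex F B).homology n :=
  quotDesc F (toHomology F n B) (mapπ_toHomology F n B)

lemma quotPowProj_quotToHomology (F : C ⥤ D) [F.Additive] (n : ℕ) (B : C) :
    quotPowProj F n B ≫ quotToHomology F n B = toHomology F n B :=
  quotProj_desc F _ _

/-- The morphism `F̲ ∘ Ωⁿ⁺¹ ⟶ LₙF`, induced by the inclusion `Ωⁿ⁺¹ B ⟶ Pₙ`. For `n = 0` this is
`α_F`. -/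
def alpha (F : C ⥤ D) [F.Additive] (n : ℕ) : quotStabSyz F (n + 1) ⟶ F.leftDerived n where
  app B := quotToHomology F n B ≫ (derivedIso F n B).inv
  naturality B B' f := by
    rw [← cancel_mono (derivedIso F n B').hom, Category.assoc, Category.assoc, Category.assoc,
      derivedIso_hom_naturality, Category.assoc, Iso.inv_hom_id_assoc, Iso.inv_hom_id,
      Category.comp_id, ← cancel_epi (quotPowProj F n B), ← Category.assoc,
      ← quotPowProj_naturality, Category.assoc, quotPowProj_quotToHomology,
      toHomology_naturality, ← Category.assoc, quotPowProj_quotToHomology]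

/-- The inclusion of the satellite `Sₙ₊₁F(B)` in `F(Ωⁿ⁺¹ B)`. -/
def satPowι (F : C ⥤ D) [F.Additive] (n : ℕ) (B : C) :
    (satellite F (n + 1)).obj B ⟶ F.obj (syzPow (n + 1) B) := satι F (syzPow n B)

instance (F : C ⥤ D) [F.Additive] (n : ℕ) (B : C) : Mono (satPowι F n B) :=
  inferInstanceAs (Mono (satι F (syzPow n B)))

lemma satPowι_naturality (F : C ⥤ D) [F.Additive] (n : ℕ) {B B' : C} (f : B ⟶ B') :
    (satellite F (n + 1)).map f ≫ satPowι F n B' =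
      satPowι F n B ≫ F.map (syzPowMap (n + 1) f) :=
  satellite₁_map_ι F (syzPowMap n f)

/-- The morphism `Sₙ F ⟶ F̲ ∘ Ωⁿ`. For `n = 0` this is the projection `F ⟶ F̲`; for `n > 0` it is
the composition of `Sₙ F(B) ⟶ F(Ωⁿ B)` and `F(Ωⁿ B) ⟶ F̲(Ωⁿ B)`. -/
def satToQuot (F : C ⥤ D) [F.Additive] : ∀ n : ℕ, satellite F n ⟶ quotStabSyz F n
  | 0 => quotProj F
  | n + 1 =>
    { app := fun B => satPowι F n B ≫ quotPowProj F n B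
      naturality := fun B B' f => by
        rw [← Category.assoc, satPowι_naturality, Category.assoc, quotPowProj_naturality,
          Category.assoc] }

lemma d_mapπ (F : C ⥤ D) [F.Additive] (n : ℕ) (B : C) :
    (mapSyzComplex F B).d (n + 1) n ≫ mapπ F n B = 0 := by
  rw [mapSyzComplex_d, Category.assoc, mapι_mapπ, comp_zero]

/-- The morphism `Hₙ(F(P)) ⟶ F(Ωⁿ B)` induced by the projection `Pₙ ⟶ Ωⁿ B`. -/
def fromHomology (F : C ⥤ D) [F.Additive] (n : ℕ) (B : C) :
    (mapSyzComplex F B).homology n ⟶ F.obj (syzPow n B) :=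
  (mapSyzComplex F B).homologyι n ≫
    (mapSyzComplex F B).descOpcycles (mapπ F n B) (n + 1) (by simp) (d_mapπ F n B)

lemma fromHomology_mapι (F : C ⥤ D) [F.Additive] (n : ℕ) (B : C) :
    fromHomology F (n + 1) B ≫ mapι F n B = 0 := by
  refine Eq.trans ?_ ((mapSyzComplex F B).homologyι_comp_fromOpcycles (n + 1) n)
  refine (Category.assoc _ _ _).trans ?_
  congr 1
  rw [← cancel_epi ((mapSyzComplex F B).pOpcycles (n + 1)), HomologicalComplex.p_fromOpcycles,
    mapSyzComplex_d, ← Category.assoc]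
  exact congrArg (fun z => z ≫ mapι F n B) (HomologicalComplex.p_descOpcycles _ _ _ _ _)

lemma fromHomology_naturality (F : C ⥤ D) [F.Additive] (n : ℕ) {B B' : C} (f : B ⟶ B') :
    HomologicalComplex.homologyMap (mapSyzComplexMap F f) n ≫ fromHomology F n B' =
      fromHomology F n B ≫ F.map (syzPowMap n f) := by
  rw [fromHomology, fromHomology, Category.assoc,
    HomologicalComplex.homologyι_naturality_assoc]
  congr 1
  rw [← cancel_epi ((mapSyzComplex F B).pOpcycles n), HomologicalComplex.p_opcyclesMap_assoc,
    HomologicalComplex.p_descOpcycles, HomologicalComplex.p_descOpcycles_assoc]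
  exact (F.map_comp _ _).symm.trans
    ((congrArg F.map (overMap_π (syzPowMap n f))).trans (F.map_comp _ _))

/-- The morphism `Hₙ₊₁(F(P)) ⟶ Sₙ₊₁F(B)` induced by the projection `Pₙ₊₁ ⟶ Ωⁿ⁺¹ B`. -/
def homologyToSat (F : C ⥤ D) [F.Additive] (n : ℕ) (B : C) :
    (mapSyzComplex F B).homology (n + 1) ⟶ (satellite F (n + 1)).obj B :=
  satLift F (fromHomology F (n + 1) B) (fromHomology_mapι F n B)

lemma homologyToSat_ι (F : C ⥤ D) [F.Additive] (n : ℕ) (B : C) :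
    homologyToSat F n B ≫ satPowι F n B = fromHomology F (n + 1) B :=
  satLift_ι F _ _

/-- The morphism `Lₙ F ⟶ Sₙ F`. For `n = 0` this is `λ_F : L₀F ⟶ F`; for `n > 0` it is induced by
the projection `Pₙ ⟶ Ωⁿ B`. -/
def derivedToSat (F : C ⥤ D) [F.Additive] : ∀ n : ℕ, F.leftDerived n ⟶ satellite F n
  | 0 => F.fromLeftDerivedZero
  | n + 1 =>
    { app := fun B => (derivedIso F (n + 1) B).hom ≫ homologyToSat F n B
      naturality := fun B B' f => by
        rw [← Category.assoc, derivedIso_hom_naturality, Category.assoc, Category.assoc]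
        congr 1
        rw [← cancel_mono (satPowι F n B'), Category.assoc, Category.assoc, satPowι_naturality,
          homologyToSat_ι, fromHomology_naturality, ← Category.assoc, homologyToSat_ι] }

/-! ## The left fundamental sequence -/

/-- Auxiliary definition: the terms of the sequence
`F̲ ∘ Ωᵏ, Sₖ F, Lₖ F, F̲ ∘ Ωᵏ⁺¹, Sₖ₊₁ F, Lₖ₊₁ F, …`. -/
def termFrom (F : C ⥤ D) [F.Additive] : ℕ → ℕ → (C ⥤ D)
  | 0, k => quotStabSyz F k
  | 1, k => satellite F k
  | 2, k => F.leftDerived k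
  | n + 3, k => termFrom F n (k + 1)

/-- Auxiliary definition: the morphisms of the sequence
`⋯ ⟶ F̲ ∘ Ωᵏ⁺¹ ⟶ Lₖ F ⟶ Sₖ F ⟶ F̲ ∘ Ωᵏ`. -/
def diffFrom (F : C ⥤ D) [F.Additive] : ∀ n k : ℕ, termFrom F (n + 1) k ⟶ termFrom F n k
  | 0, k => satToQuot F k
  | 1, k => derivedToSat F k
  | 2, k => alpha F k
  | n + 3, k => diffFrom F n (k + 1)

/-- The terms of the left fundamental sequence
`⋯ ⟶ L₁F ⟶ S₁F ⟶ F̲ ∘ Ω ⟶ L₀F ⟶ F ⟶ F̲ ⟶ 0`, numbered from the right starting with `0`: the terms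
number `3k`, `3k + 1`, `3k + 2` are `F̲ ∘ Ωᵏ`, `SₖF` (with `S₀F = F`) and `LₖF`. -/
def term (F : C ⥤ D) [F.Additive] (n : ℕ) : C ⥤ D := termFrom F n 0

/-- The morphisms of the left fundamental sequence, `diff F n` going from the term number `n + 1`
to the term number `n`. -/
def diff (F : C ⥤ D) [F.Additive] (n : ℕ) : term F (n + 1) ⟶ term F n := diffFrom F n 0

/-- Consecutive morphisms of the left fundamental sequence compose to zero at the term number
`n + 1`, and the homology there vanishes, i.e. the sequence of functors is exact there. -/
def ExactAtSucc (F : C ⥤ D) [F.Additive] (n : ℕ) : Prop :=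
  ∃ w : diff F (n + 1) ≫ diff F n = 0, (ShortComplex.mk (diff F (n + 1)) (diff F n) w).Exact

end LeftFundamental

end

noncomputable section

namespace LeftFundamental

section

variable {C : Type u} [Category.{v} C] {D : Type u'} [Category.{v'} D] [Abelian D]

/-! Exactness of functors is tested at each object and on generalized elements, that is, morphisms
`A ⟶ G.obj B` considered up to epimorphisms onto `A`. Write `ι : F(Ωⁿ⁺¹B) ⟶ F(Pₙ)` and `π : F(Pₙ) ⟶
F(ΩⁿB)` for the maps induced by the spliced sequences. Then the differential `F(Pₙ₊₁) ⟶ F(Pₙ)` is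
`π` followed by `ι`, the kernel of `ι` is `Sₙ₊₁F(B)`, the cokernel of `π` is `F̲(ΩⁿB)`, and `ι`
followed by `π` is zero.

Chasing these facts gives exactness at `SₖF` (`exact_derivedToSat_satToQuot`) and at `F̲ ∘ Ωᵏ⁺¹`
(`exact_satToQuot_alpha`) for every additive `F`. At `LₖF` the composite vanishes because `ι`
followed by `π` does, but a cycle killed by `π` need not come from `ι`; half-exactness, applied to
`0 ⟶ Ωᵏ⁺¹B ⟶ Pₖ ⟶ ΩᵏB ⟶ 0`, supplies exactly this.

If `F` preserves monomorphisms then `S₁F = 0`, so exactness makes `α_F` a monomorphism; if it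
preserves epimorphisms then `π` is epi and its cokernel `F̲` vanishes. If `λ_F` is an isomorphism,
`F(P₁) ⟶ F(P₀) ⟶ F(B) ⟶ 0` is exact, and right exactness on an arbitrary short exact sequence
follows by comparing it with the chosen projective presentations (`exact_map_of_shortExact`). -/

/-- A short complex of functors is exact if it is exact at every object. -/
lemma exact_of_exact_app {S : ShortComplex (C ⥤ D)}
    (h : ∀ B : C, (S.map ((evaluation C D).obj B)).Exact) : S.Exact := by
  rw [ShortComplex.exact_iff_isZero_homology]
  refine Functor.isZero _ fun B => ?_
  exact ((ShortComplex.exact_iff_isZero_homology _).1 (h B)).of_iso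
    (S.mapHomologyIso ((evaluation C D).obj B)).symm

/-- Exactness of functors, checked on generalized elements. -/
lemma exact_of_exact_up_to_refinements {G₁ G₂ G₃ : C ⥤ D} {f : G₁ ⟶ G₂} {g : G₂ ⟶ G₃}
    (w : f ≫ g = 0)
    (h : ∀ (B : C) (A : D) (x : A ⟶ G₂.obj B), x ≫ g.app B = 0 →
      ∃ (A' : D) (p : A' ⟶ A) (_ : Epi p) (y : A' ⟶ G₁.obj B), p ≫ x = y ≫ f.app B) :
    (ShortComplex.mk f g w).Exact :=
  exact_of_exact_app fun B =>
    (ShortComplex.exact_iff_exact_up_to_refinements _).2 fun A x hx => h B A x hx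

end

variable {C : Type u} [Category.{v} C] [Abelian C] [EnoughProjectives C]
variable {D : Type u'} [Category.{v'} D] [Abelian D]
variable (F : C ⥤ D) [F.Additive]

/-! ## Generalized elements of the terms of the sequence -/

lemma map_π_quotProj (B : C) : F.map (Projective.π B) ≫ (quotProj F).app B = 0 := by
  rw [(quotProj F).naturality,
    (quotStab_vanishes F _ inferInstance).eq_of_tgt ((quotProj F).app _) 0, zero_comp]

/-- The projection of `F(B)` onto the cokernel of `F(P) ⟶ F(B)` factors through `quotProj` via
`quotDesc`, so an element dying in `F̲(B)` dies in that cokernel and lifts locally to `F(P)`. -/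
lemma comp_quotProj_eq_zero {A : D} {B : C} (x : A ⟶ F.obj B)
    (hx : x ≫ (quotProj F).app B = 0) :
    ∃ (A' : D) (p : A' ⟶ A) (_ : Epi p) (y : A' ⟶ F.obj (Projective.over B)),
      p ≫ x = y ≫ F.map (Projective.π B) := by
  refine (CokernelCofork.IsColimit.comp_π_eq_zero_iff_up_to_refinements
    (cokernelIsCokernel (F.map (Projective.π B))) x).1 ?_
  refine (congrArg _ (quotProj_desc F (cokernel.π _) (cokernel.condition _)).symm).trans ?_
  exact (Category.assoc _ _ _).symm.trans ((congrArg (fun z => z ≫ _) hx).trans zero_comp)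

/-- This and the next lemma retype the previous two, so that the lifts live in the terms of
`mapSyzComplex`, where cycles and boundaries are formed. -/
lemma mapπ_quotPowProj (n : ℕ) (B : C) : mapπ F (n + 1) B ≫ quotPowProj F n B = 0 :=
  map_π_quotProj F _

lemma comp_quotPowProj_eq_zero {A : D} (n : ℕ) {B : C} (x : A ⟶ F.obj (syzPow (n + 1) B))
    (hx : x ≫ quotPowProj F n B = 0) :
    ∃ (A' : D) (p : A' ⟶ A) (_ : Epi p) (y : A' ⟶ (mapSyzComplex F B).X (n + 1)),
      p ≫ x = y ≫ mapπ F (n + 1) B :=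
  comp_quotProj_eq_zero F x hx

lemma satPowι_mapι (n : ℕ) (B : C) : satPowι F n B ≫ mapι F n B = 0 :=
  satι_condition F (syzPow n B)

lemma exists_satPowι {A : D} (n : ℕ) {B : C} (x : A ⟶ F.obj (syzPow (n + 1) B))
    (hx : x ≫ mapι F n B = 0) :
    ∃ y : A ⟶ (satellite F (n + 1)).obj B, y ≫ satPowι F n B = x :=
  ⟨satLift F x hx, satLift_ι F x hx⟩

/-- The class in `Hₙ(F(P))` of a generalized cycle. -/
def homologyClass {n : ℕ} {B : C} {A : D} (z : A ⟶ (mapSyzComplex F B).X n)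
    (hz : z ≫ (mapSyzComplex F B).d n ((ComplexShape.down ℕ).next n) = 0) :
    A ⟶ (mapSyzComplex F B).homology n :=
  (mapSyzComplex F B).liftCycles z _ rfl hz ≫ (mapSyzComplex F B).homologyπ n

lemma exists_homologyClass {n : ℕ} {B : C} {A : D} (x : A ⟶ (mapSyzComplex F B).homology n) :
    ∃ (A' : D) (p : A' ⟶ A) (_ : Epi p) (z : A' ⟶ (mapSyzComplex F B).X n)
      (hz : z ≫ (mapSyzComplex F B).d n ((ComplexShape.down ℕ).next n) = 0),
      p ≫ x = homologyClass F z hz :=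
  (mapSyzComplex F B).eq_liftCycles_homologyπ_up_to_refinements x _ rfl

lemma homologyClass_eq_zero_iff {n : ℕ} {B : C} {A : D} (z : A ⟶ (mapSyzComplex F B).X n)
    (hz : z ≫ (mapSyzComplex F B).d n ((ComplexShape.down ℕ).next n) = 0) :
    homologyClass F z hz = 0 ↔
      ∃ (A' : D) (p : A' ⟶ A) (_ : Epi p) (y : A' ⟶ (mapSyzComplex F B).X (n + 1)),
        p ≫ z = y ≫ mapπ F (n + 1) B ≫ mapι F n B := by
  rw [← mapSyzComplex_d]
  exact (mapSyzComplex F B).liftCycles_comp_homologyπ_eq_zero_iff_up_to_refinements (n + 1) n _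
    (by simp) rfl z hz

lemma comp_homologyClass {n : ℕ} {B : C} {A A' : D} (p : A' ⟶ A)
    (z : A ⟶ (mapSyzComplex F B).X n)
    (hz : z ≫ (mapSyzComplex F B).d n ((ComplexShape.down ℕ).next n) = 0) :
    p ≫ homologyClass F z hz =
      homologyClass F (p ≫ z) (by rw [Category.assoc, hz, comp_zero]) := by
  rw [homologyClass, homologyClass, ← Category.assoc]
  congr 1
  rw [← cancel_mono ((mapSyzComplex F B).iCycles n), Category.assoc,
    HomologicalComplex.liftCycles_i, HomologicalComplex.liftCycles_i]

lemma comp_toHomology {n : ℕ} {B : C} {A : D} (x : A ⟶ F.obj (syzPow (n + 1) B)) :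
    x ≫ toHomology F n B = homologyClass F (x ≫ mapι F n B)
      (by rw [Category.assoc, mapι_d, comp_zero]) :=
  comp_homologyClass F x (mapι F n B) (mapι_d F n B)

lemma homologyClass_fromHomology {n : ℕ} {B : C} {A : D} (z : A ⟶ (mapSyzComplex F B).X n)
    (hz : z ≫ (mapSyzComplex F B).d n ((ComplexShape.down ℕ).next n) = 0) :
    homologyClass F z hz ≫ fromHomology F n B = z ≫ mapπ F n B := by
  rw [homologyClass, fromHomology, Category.assoc, HomologicalComplex.homology_π_ι_assoc,
    HomologicalComplex.liftCycles_i_assoc, HomologicalComplex.p_descOpcycles]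

/-- Cycles of positive degree are the elements that `π` sends into the satellite, since the
differential is `π` followed by `ι`. -/
lemma comp_mapι_eq_zero_iff {n : ℕ} {B : C} {A : D} (z : A ⟶ (mapSyzComplex F B).X (n + 1)) :
    z ≫ mapπ F (n + 1) B ≫ mapι F n B = 0 ↔
      z ≫ (mapSyzComplex F B).d (n + 1) ((ComplexShape.down ℕ).next (n + 1)) = 0 := by
  rw [ChainComplex.next_nat_succ, mapSyzComplex_d]

/-- The morphism `λ_F` in terms of the spliced resolution. -/
lemma fromLeftDerivedZero_app (B : C) :
    F.fromLeftDerivedZero.app B = (derivedIso F 0 B).hom ≫ fromHomology F 0 B := by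
  refine ((syzResolution B).fromLeftDerivedZero_eq F).trans ?_
  refine congrArg (fun z => (derivedIso F 0 B).hom ≫ z) ?_
  refine congrArg (fun z => (mapSyzComplex F B).homologyι 0 ≫ z) ?_
  -- Both maps out of the opcycles in degree `0` are determined by their restriction to `F(P₀)`,
  -- which is `F` of the augmentation in each case.
  refine (cancel_epi ((mapSyzComplex F B).pOpcycles 0)).1 ?_
  refine (ProjectiveResolution.pOpcycles_comp_fromLeftDerivedZero' _ F).trans ?_
  refine Eq.trans ?_ (HomologicalComplex.p_descOpcycles _ _ _ _ _).symm
  exact congrArg F.map (syzAug_f B)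

/-! ## Exactness at the satellites -/

/-- For `k = 0` this is the definition of `F̲` as a cokernel. In positive degree an element of the
satellite dying in `F̲` lifts along `π` to some `y`; since satellite elements are killed by `ι`,
this `y` is a cycle, and its class is the required preimage. -/
lemma exact_derivedToSat_satToQuot : ∀ k : ℕ, ∃ w : derivedToSat F k ≫ satToQuot F k = 0,
    (ShortComplex.mk (derivedToSat F k) (satToQuot F k) w).Exact
  | 0 => ⟨cokernel.condition F.fromLeftDerivedZero,
      ShortComplex.exact_of_g_is_cokernel _ (cokernelIsCokernel F.fromLeftDerivedZero)⟩
  | k + 1 => by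
    have key : ∀ B, homologyToSat F k B ≫ satPowι F k B ≫ quotPowProj F k B = 0 := fun B => by
      rw [← Category.assoc, homologyToSat_ι]
      -- The universal element `𝟙` of the homology is represented by a cycle after a cover `p`; an
      -- identity of morphisms may be checked on it.
      obtain ⟨A, p, _, z, hz, e⟩ := exists_homologyClass F (𝟙 ((mapSyzComplex F B).homology (k + 1)))
      rw [← cancel_epi p, comp_zero, ← Category.comp_id p, Category.assoc, ← Category.assoc p, e,
        ← Category.assoc, homologyClass_fromHomology, Category.assoc, mapπ_quotPowProj, comp_zero]
    refine ⟨?_, ?_⟩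
    · ext B : 2
      refine (Category.assoc _ _ _).trans ?_
      exact (congrArg _ (key B)).trans comp_zero
    · refine exact_of_exact_up_to_refinements _ fun B A x hx => ?_
      obtain ⟨A', p, hp, y, e⟩ := comp_quotPowProj_eq_zero F k (x ≫ satPowι F k B)
        ((Category.assoc _ _ _).trans hx)
      have hy : y ≫ mapπ F (k + 1) B ≫ mapι F k B = 0 := by
        rw [← Category.assoc, ← e, Category.assoc, Category.assoc, satPowι_mapι, comp_zero,
          comp_zero]
      refine ⟨A', p, hp, homologyClass F y ((comp_mapι_eq_zero_iff F y).1 hy) ≫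
        (derivedIso F (k + 1) B).inv, ?_⟩
      refine Eq.trans ?_ (Category.assoc _ _ _).symm
      refine Eq.trans ?_ (congrArg _ (Iso.inv_hom_id_assoc _ _).symm)
      rw [← cancel_mono (satPowι F k B), Category.assoc, Category.assoc, homologyToSat_ι,
        homologyClass_fromHomology, e]

/-! ## Exactness at the quot-stabilizations -/

lemma satPowι_toHomology (n : ℕ) (B : C) : satPowι F n B ≫ toHomology F n B = 0 := by
  rw [comp_toHomology, homologyClass_eq_zero_iff]
  exact ⟨_, 𝟙 _, inferInstance, 0, by rw [satPowι_mapι, comp_zero, zero_comp]⟩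

/-- Lift an element of `F̲(Ωᵏ⁺¹B)` to `y` in `F(Ωᵏ⁺¹B)`. If its class in homology vanishes, `ι`
sends `y` to a boundary, that is, to the image under `ι` of some `π(t)`. Then `y - π(t)` lies in the
satellite and has the same image in `F̲`. -/
lemma exact_satToQuot_alpha (k : ℕ) : ∃ w : satToQuot F (k + 1) ≫ alpha F k = 0,
    (ShortComplex.mk (satToQuot F (k + 1)) (alpha F k) w).Exact := by
  have key : ∀ B, (satPowι F k B ≫ quotPowProj F k B) ≫ quotToHomology F k B = 0 := fun B => by
    rw [Category.assoc, quotPowProj_quotToHomology, satPowι_toHomology]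
  refine ⟨?_, ?_⟩
  · ext B : 2
    refine (Category.assoc _ _ _).symm.trans ?_
    exact (congrArg (fun z => z ≫ (derivedIso F k B).inv) (key B)).trans zero_comp
  · refine exact_of_exact_up_to_refinements _ fun B A x hx => ?_
    replace hx : x ≫ quotToHomology F k B = 0 := by
      rw [← cancel_mono (derivedIso F k B).inv, Category.assoc, zero_comp]
      exact hx
    obtain ⟨A₁, p₁, _, y, e₁⟩ := surjective_up_to_refinements_of_epi (quotPowProj F k B) x
    have hy : y ≫ toHomology F k B = 0 := by
      rw [← quotPowProj_quotToHomology, ← Category.assoc, ← e₁, Category.assoc, hx, comp_zero]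
    rw [comp_toHomology, homologyClass_eq_zero_iff] at hy
    obtain ⟨A₂, p₂, _, t, e₂⟩ := hy
    obtain ⟨s, hs⟩ := exists_satPowι F k (p₂ ≫ y - t ≫ mapπ F (k + 1) B)
      (by rw [Preadditive.sub_comp, Category.assoc, Category.assoc, e₂, sub_self])
    refine ⟨A₂, p₂ ≫ p₁, inferInstance, s, ?_⟩
    refine Eq.trans ?_ (Category.assoc _ _ _)
    rw [hs, Preadditive.sub_comp, Category.assoc, Category.assoc, Category.assoc,
      mapπ_quotPowProj, comp_zero, sub_zero, e₁]

/-! ## Half-exact functors and exactness at the left derived functors -/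

lemma quotToHomology_fromHomology (n : ℕ) (B : C) :
    quotToHomology F n B ≫ fromHomology F n B = 0 := by
  rw [← cancel_epi (quotPowProj F n B), ← Category.assoc, quotPowProj_quotToHomology, comp_zero,
    ← Category.id_comp (toHomology F n B), comp_toHomology, homologyClass_fromHomology,
    Category.assoc, mapι_mapπ, comp_zero]

/-- A generalized element of `LₖF(B)` is killed by `LₖF ⟶ SₖF` if and only if its image in
`Hₖ(F(P))` is killed by `fromHomology`. -/
lemma comp_derivedToSat_eq_zero_iff : ∀ (k : ℕ) {B : C} {A : D} (x : A ⟶ (F.leftDerived k).obj B),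
    x ≫ (derivedToSat F k).app B = 0 ↔ (x ≫ (derivedIso F k B).hom) ≫ fromHomology F k B = 0
  | 0, B, A, x => Iff.of_eq <| congrArg (fun z => z = 0) <|
      (congrArg (fun z => x ≫ z) (fromLeftDerivedZero_app F B)).trans (Category.assoc _ _ _).symm
  | k + 1, B, A, x => by
    rw [← homologyToSat_ι, ← Category.assoc _ _ (satPowι F k B), Category.assoc x]
    refine ⟨fun h => ?_, fun h => ?_⟩
    · exact (congrArg (fun z => z ≫ satPowι F k B) h).trans zero_comp
    · rw [← cancel_mono (satPowι F k B), zero_comp]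
      exact h

lemma alpha_app_derivedIso_hom (k : ℕ) (B : C) :
    (alpha F k).app B ≫ (derivedIso F k B).hom = quotToHomology F k B :=
  (Category.assoc _ _ _).trans ((congrArg _ (Iso.inv_hom_id _)).trans (Category.comp_id _))

lemma alpha_derivedToSat (k : ℕ) : alpha F k ≫ derivedToSat F k = 0 := by
  ext B : 2
  refine (comp_derivedToSat_eq_zero_iff F k _).2 ?_
  refine (congrArg (fun z => z ≫ fromHomology F k B) (alpha_app_derivedIso_hom F k B)).trans ?_
  exact quotToHomology_fromHomology F k B

lemma syz_shortExact (B : C) :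
    (ShortComplex.mk (syzι B) (Projective.π B) (syzι_π B)).ShortExact where
  exact := ShortComplex.exact_of_f_is_kernel _ (kernelIsKernel (Projective.π B))
  mono_f := inferInstanceAs (Mono (syzι B))
  epi_g := inferInstanceAs (Epi (Projective.π B))

variable {F} in
-- An element of the kernel is represented by a cycle `z` with `π(z) = 0`; half-exactness writes `z`
-- locally as `ι(y)`, and the image of `y` in `F̲` is the preimage.
lemma IsHalfExact.exact_alpha_derivedToSat (hF : IsHalfExact F) (k : ℕ) :
    ∃ w : alpha F k ≫ derivedToSat F k = 0,
      (ShortComplex.mk (alpha F k) (derivedToSat F k) w).Exact := by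
  refine ⟨alpha_derivedToSat F k, exact_of_exact_up_to_refinements _ fun B A x hx => ?_⟩
  rw [comp_derivedToSat_eq_zero_iff] at hx
  obtain ⟨A₁, p₁, _, z, hz, e₁⟩ := exists_homologyClass F (x ≫ (derivedIso F k B).hom)
  have hz' : z ≫ mapπ F k B = 0 := by
    rw [← homologyClass_fromHomology F z hz, ← e₁, Category.assoc, hx, comp_zero]
  obtain ⟨A₂, p₂, _, y, e₂⟩ : ∃ (A₂ : D) (p₂ : A₂ ⟶ A₁) (_ : Epi p₂)
      (y : A₂ ⟶ F.obj (syzPow (k + 1) B)), p₂ ≫ z = y ≫ mapι F k B :=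
    (hF _ (syz_shortExact (syzPow k B))).exact_up_to_refinements z hz'
  refine ⟨A₂, p₂ ≫ p₁, inferInstance, y ≫ quotPowProj F k B, ?_⟩
  rw [← cancel_mono (derivedIso F k B).hom]
  rw [Category.assoc (y ≫ _), alpha_app_derivedIso_hom, Category.assoc y,
    quotPowProj_quotToHomology, Category.assoc, Category.assoc, e₁, comp_homologyClass,
    comp_toHomology]
  congr 1

/-! ## The sequence -/

/-- The sequence has period three, each period raising `k` by one; `hF` isolates the terms `LₖF`,
where exactness is not automatic. -/
lemma exact_diffFrom (F : C ⥤ D) [F.Additive] (hF : ∀ k, ∃ w : alpha F k ≫ derivedToSat F k = 0,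
      (ShortComplex.mk (alpha F k) (derivedToSat F k) w).Exact) :
    ∀ n k : ℕ, ∃ w : diffFrom F (n + 1) k ≫ diffFrom F n k = 0,
      (ShortComplex.mk (diffFrom F (n + 1) k) (diffFrom F n k) w).Exact
  | 0, k => exact_derivedToSat_satToQuot F k
  | 1, k => hF k
  | 2, k => exact_satToQuot_alpha F k
  -- `termFrom` and `diffFrom` shift definitionally, so the recursion needs no transport.
  | n + 3, k => exact_diffFrom F hF n (k + 1)

lemma diffFrom_comp (F : C ⥤ D) [F.Additive] :
    ∀ n k : ℕ, diffFrom F (n + 1) k ≫ diffFrom F n k = 0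
  | 0, k => (exact_derivedToSat_satToQuot F k).1
  | 1, k => alpha_derivedToSat F k
  | 2, k => (exact_satToQuot_alpha F k).1
  | n + 3, k => diffFrom_comp F n (k + 1)

/-- Exactness is asserted at the term number `n + 1`, which is some `LₖF` exactly when `n + 1` is
`2` modulo `3`. -/
lemma exact_diffFrom_of_mod_ne (F : C ⥤ D) [F.Additive] :
    ∀ n k : ℕ, (n + 1) % 3 ≠ 2 → ∃ w : diffFrom F (n + 1) k ≫ diffFrom F n k = 0,
      (ShortComplex.mk (diffFrom F (n + 1) k) (diffFrom F n k) w).Exact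
  | 0, k, _ => exact_derivedToSat_satToQuot F k
  | 1, _, h => absurd rfl h
  | 2, k, _ => exact_satToQuot_alpha F k
  | n + 3, k, h => exact_diffFrom_of_mod_ne F n (k + 1) (by omega)

/-! ## Functors preserving monomorphisms or epimorphisms -/

lemma mono_alpha_zero [F.PreservesMonomorphisms] : Mono (alpha F 0) := by
  obtain ⟨w, h⟩ := exact_satToQuot_alpha F 0
  refine h.mono_g (IsZero.eq_of_src ?_ _ _)
  -- The source `S₁F` is zero: its value is the kernel of `F` applied to the monomorphism `ΩB ⟶ P₀`.
  exact Functor.isZero _ fun B => isZero_kernel_of_mono (F.map (syzι (syzPow 0 B)))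

lemma isZero_quotStab [F.PreservesEpimorphisms] : IsZero (quotStab F) :=
  Functor.isZero _ fun B => IsZero.of_epi_eq_zero ((quotProj F).app B)
    ((cancel_epi (F.map (Projective.π B))).1 ((map_π_quotProj F B).trans comp_zero.symm))

lemma epi_fromLeftDerivedZero [F.PreservesEpimorphisms] : Epi F.fromLeftDerivedZero :=
  Preadditive.epi_of_isZero_cokernel _ (isZero_quotStab F)

/-! ## Functors isomorphic to their zeroth left derived functor -/

section

variable [IsIso F.fromLeftDerivedZero]

lemma isIso_fromHomology (B : C) : IsIso (fromHomology F 0 B) := by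
  have h : IsIso (F.fromLeftDerivedZero.app B) := NatIso.isIso_app_of_isIso _ B
  rw [fromLeftDerivedZero_app] at h
  have h' : IsIso ((derivedIso F 0 B).hom ≫ fromHomology F 0 B) := h
  exact IsIso.of_isIso_comp_left (derivedIso F 0 B).hom (fromHomology F 0 B)

/-- The epimorphism from the degree `0` cycles onto `H₀(F(P)) ≅ F(B)` factors through `F(P₀) ⟶
F(B)`. -/
lemma epi_map_π (B : C) : Epi (F.map (Projective.π B)) := by
  have := isIso_fromHomology F B
  have h : (mapSyzComplex F B).homologyπ 0 ≫ fromHomology F 0 B =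
      (mapSyzComplex F B).iCycles 0 ≫ mapπ F 0 B := by
    rw [fromHomology, HomologicalComplex.homology_π_ι_assoc, HomologicalComplex.p_descOpcycles]
  have : Epi ((mapSyzComplex F B).homologyπ 0 ≫ fromHomology F 0 B) :=
    epi_comp' inferInstance inferInstance
  rw [h] at this
  exact epi_of_epi ((mapSyzComplex F B).iCycles 0) (mapπ F 0 B)

/-- Every element of `F(P₀)` is a cycle, and injectivity of `H₀(F(P)) ⟶ F(B)` makes one killed by
`π` a boundary; boundaries factor through `ι`. -/
lemma exact_mapι_mapπ_zero (B : C) {A : D} (x : A ⟶ (mapSyzComplex F B).X 0)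
    (hx : x ≫ mapπ F 0 B = 0) :
    ∃ (A' : D) (p : A' ⟶ A) (_ : Epi p) (y : A' ⟶ F.obj (syzPow 1 B)),
      p ≫ x = y ≫ mapι F 0 B := by
  have := isIso_fromHomology F B
  have hz : x ≫ (mapSyzComplex F B).d 0 ((ComplexShape.down ℕ).next 0) = 0 := by
    rw [HomologicalComplex.shape _ _ _ (by simp), comp_zero]
  have h : homologyClass F x hz = 0 := by
    rw [← cancel_mono (fromHomology F 0 B), homologyClass_fromHomology, zero_comp, hx]
  obtain ⟨A', p, hp, y, e⟩ := (homologyClass_eq_zero_iff F x hz).1 h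
  exact ⟨A', p, hp, y ≫ mapπ F 1 B, e.trans (Category.assoc _ _ _).symm⟩

lemma exact_map_syz (B : C) {A : D} (x : A ⟶ F.obj (Projective.over B))
    (hx : x ≫ F.map (Projective.π B) = 0) :
    ∃ (A' : D) (p : A' ⟶ A) (_ : Epi p) (y : A' ⟶ F.obj (syz B)), p ≫ x = y ≫ F.map (syzι B) :=
  exact_mapι_mapπ_zero F B x hx

lemma epi_map_of_epi {X Y : C} (g : X ⟶ Y) [Epi g] : Epi (F.map g) := by
  have := epi_map_π F Y
  have h : F.map (Projective.factorThru (Projective.π Y) g) ≫ F.map g = F.map (Projective.π Y) := by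
    rw [← F.map_comp, Projective.factorThru_comp]
  exact epi_of_epi_fac h

/-- If `λ_F` is an isomorphism, then `F` is exact in the middle on short exact sequences. -/
lemma exact_map_of_shortExact (S : ShortComplex C) (hS : S.ShortExact) : (S.map F).Exact := by
  have := hS.mono_f
  have := hS.epi_g
  have := epi_map_π F S.X₂
  let ψ : Projective.over S.X₃ ⟶ S.X₂ := Projective.factorThru (Projective.π S.X₃) S.g
  have hψ : ψ ≫ S.g = Projective.π S.X₃ := Projective.factorThru_comp _ _
  have hφ : overMap S.g ≫ Projective.π S.X₃ = Projective.π S.X₂ ≫ S.g := overMap_π S.g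
  -- Correcting the projection `P(X₂) ⟶ X₂` by the detour through `P(X₃)` yields a map killed by
  -- `g`; hence it factors as `t` followed by `f`. Likewise `ψ` restricted to `ΩX₃` factors as `s`
  -- followed by `f`.
  have ht := hS.exact.lift_f (Projective.π S.X₂ - overMap S.g ≫ ψ)
    (by rw [Preadditive.sub_comp, Category.assoc, hψ, hφ, sub_self])
  have hs := hS.exact.lift_f (syzι S.X₃ ≫ ψ) (by rw [Category.assoc, hψ, syzι_π])
  set t := hS.exact.lift (Projective.π S.X₂ - overMap S.g ≫ ψ) _
  set s := hS.exact.lift (syzι S.X₃ ≫ ψ) _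
  suffices ∀ (A : D) (x : A ⟶ F.obj S.X₂), x ≫ F.map S.g = 0 →
      ∃ (A' : D) (p : A' ⟶ A) (_ : Epi p) (y : A' ⟶ F.obj S.X₁), p ≫ x = y ≫ F.map S.f from
    (ShortComplex.exact_iff_exact_up_to_refinements _).2 fun A x hx => this A x hx
  intro A x hx
  obtain ⟨A₁, p₁, _, y, e₁⟩ :=
    surjective_up_to_refinements_of_epi (F.map (Projective.π S.X₂)) x
  obtain ⟨A₂, p₂, _, z, e₂⟩ := exact_map_syz F S.X₃ (y ≫ F.map (overMap S.g)) (by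
    rw [Category.assoc, ← F.map_comp, hφ, F.map_comp, ← Category.assoc y, ← e₁, Category.assoc, hx,
      comp_zero])
  -- With `x` the image of `y` from `F(P(X₂))`, and the image of `y` in `F(P(X₃))` coming from `z`
  -- in `F(ΩX₃)`, the part of `x` through `ψ` is `f(s(z))` and the rest is `f(t(y))`.
  refine ⟨A₂, p₂ ≫ p₁, inferInstance, z ≫ F.map s + p₂ ≫ y ≫ F.map t, ?_⟩
  rw [Preadditive.add_comp, Category.assoc, Category.assoc, Category.assoc, Category.assoc,
    ← F.map_comp, ← F.map_comp, hs, ht, F.map_comp, ← Category.assoc z, ← e₂, F.map_sub,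
    F.map_comp, Preadditive.comp_sub, Preadditive.comp_sub, e₁]
  simp only [Category.assoc, add_sub_cancel]

end

lemma isIso_fromLeftDerivedZero_iff :
    IsIso F.fromLeftDerivedZero ↔ PreservesFiniteColimits F := by
  refine ⟨fun _ => ?_, fun _ => inferInstance⟩
  rw [Functor.preservesFiniteColimits_iff_forall_exact_map_and_epi]
  intro S hS
  have := hS.epi_g
  exact ⟨exact_map_of_shortExact F S hS, epi_map_of_epi F S.g⟩

end LeftFundamental

end

theorem mainTheorem2 {C : Type u} [Category.{v} C] [Abelian C] [EnoughProjectives C]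
    (F : C ⥤ AddCommGrpCat.{w}) [F.Additive] :
    -- the left fundamental sequence is a complex, with zero homology except possibly at the `LₖF`
    ((∀ n : ℕ, LeftFundamental.diff F (n + 1) ≫ LeftFundamental.diff F n = 0) ∧
      Epi (LeftFundamental.diff F 0) ∧
      ∀ n : ℕ, (n + 1) % 3 ≠ 2 → LeftFundamental.ExactAtSucc F n) ∧
    -- if `F` is half-exact, then the sequence is exact
    (LeftFundamental.IsHalfExact F →
      Epi (LeftFundamental.diff F 0) ∧ ∀ n : ℕ, LeftFundamental.ExactAtSucc F n) ∧
    (F.PreservesMonomorphisms → Mono (LeftFundamental.alpha F 0)) ∧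
    (F.PreservesEpimorphisms → IsZero (LeftFundamental.quotStab F) ∧ Epi F.fromLeftDerivedZero) ∧
    (IsIso F.fromLeftDerivedZero ↔ PreservesFiniteColimits F) := by
  refine ⟨⟨fun n => LeftFundamental.diffFrom_comp F n 0, ?_,
    fun n hn => LeftFundamental.exact_diffFrom_of_mod_ne F n 0 hn⟩,
    fun hF => ⟨?_, fun n => LeftFundamental.exact_diffFrom F hF.exact_alpha_derivedToSat n 0⟩,
    fun _ => LeftFundamental.mono_alpha_zero F,
    fun _ => ⟨LeftFundamental.isZero_quotStab F, LeftFundamental.epi_fromLeftDerivedZero F⟩,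
    LeftFundamental.isIso_fromLeftDerivedZero_iff F⟩
  -- The two remaining goals are exactness at the last term `F̲`, where `diff F 0` is the cokernel
  -- projection.
  all_goals exact inferInstanceAs (Epi (LeftFundamental.quotProj F))
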